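/- All groups are finite. A (possibly empty) formation is an isomorphism-closed class of finite groups, closed under quotients and such that $G/M, G/N$ in the class imply $G/(M\cap N)$ in the class. Let $\mathfrak F$ be a saturated formation of finite soluble groups (that is, a formation of soluble groups such that $G/\Phi(G)\in\mathfrak F$ implies $G\in\mathfrak F$), and let $f$ be an integrated local definition of $\mathfrak F$: for each prime $p$, $f(p)$ is a (possibly empty) formation with $f(p)\subseteq\mathfrak F$, and $\mathfrak F$ is the class of all finite soluble groups $G$ such that $G/C_G(A/B)\in f(p)$ for every prime $p$ and every chief factor $A/B$ of $G$ of $p$-power order. Let $F$ be a field of prime characteristic $p$, let $G\in\mathfrak F$ and let $V$ be a finite-dimensional $FG$-module. An irreducible $FG$-module $U$ is called $\mathfrak F$-central if $G/C_G(U)\in f(p)$, and $\mathfrak F$-eccentric otherwise; $V$ is called $\mathfrak F$-hypereccentric if every composition factor of $V$ is $\mathfrak F$-eccentric. **Theorem.** Suppose that $H^1(X,V)=0$ for every group $X\in\mathfrak F$ and every epimorphism $\varepsilon\colon X\to G$, where $V$ is regarded as an $FX$-module via $\varepsilon$. Then $V$ is $\mathfrak F$-hypereccentric. -/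

import Mathlib

universe u

/-- A class of groups: a property of groups (isomorphism invariance is part of `IsFormation`). -/
abbrev GroupClass : Type (u + 1) := ∀ (G : Type u) [Group G], Prop

/-- A (possibly empty) formation: a class of finite groups, closed under isomorphisms, under
quotients and under finite subdirect products. -/
structure IsFormation (C : GroupClass.{u}) : Prop where
  finite : ∀ (G : Type u) [Group G], C G → Finite G
  iso : ∀ (G H : Type u) [Group G] [Group H], (G ≃* H) → C G → C H
  quotient : ∀ (G : Type u) [Group G] (N : Subgroup G) [N.Normal], C G → C (G ⧸ N)
  subdirect : ∀ (G : Type u) [Group G] [Finite G] (M N : Subgroup G) [M.Normal] [N.Normal],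
    C (G ⧸ M) → C (G ⧸ N) → C (G ⧸ (M ⊓ N))

/-- A saturated formation of finite soluble groups: a formation of soluble groups that contains
every finite group whose quotient by the Frattini subgroup it contains. -/
structure IsSaturatedFormation (C : GroupClass.{u}) : Prop extends IsFormation C where
  solvable : ∀ (G : Type u) [Group G], C G → Group.IsSolvable G
  saturated : ∀ (G : Type u) [Group G] [Finite G], C (G ⧸ frattini G) → C G

/-- `A / B` is a chief factor of `G`: `B < A` are normal subgroups of `G` and no normal subgroup
of `G` lies strictly between them. -/
structure IsChiefFactor {G : Type u} [Group G] (A B : Subgroup G) : Prop where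
  normal_top : A.Normal
  normal_bot : B.Normal
  lt : B < A
  eq_or_eq : ∀ N : Subgroup G, N.Normal → B ≤ N → N ≤ A → N = B ∨ N = A

/-- The centraliser `C_G(A / B)` of a section `A / B` of `G` with `A`, `B` normal in `G`: the
preimage in `G` of the centraliser of the image of `A` in `G ⧸ B`. -/
def sectionCentralizer {G : Type u} [Group G] (A B : Subgroup G) [B.Normal] : Subgroup G :=
  (Subgroup.centralizer (A.map (QuotientGroup.mk' B) : Set (G ⧸ B))).comap (QuotientGroup.mk' B)

instance sectionCentralizer_normal {G : Type u} [Group G] (A B : Subgroup G) [hA : A.Normal]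
    [B.Normal] : (sectionCentralizer A B).Normal := by
  have : (A.map (QuotientGroup.mk' B)).Normal :=
    hA.map _ (QuotientGroup.mk'_surjective B)
  unfold sectionCentralizer
  infer_instance

/-- The class `loc(f)` locally defined by `f`: the finite soluble groups `G` such that, for every
prime `p` and every chief factor `A / B` of `G` of `p`-power order, `G / C_G(A / B)` lies
in `f p`. -/
def Loc (f : ℕ → GroupClass.{u}) : GroupClass.{u} := fun G _ =>
  Finite G ∧ Group.IsSolvable G ∧
    ∀ p : ℕ, p.Prime → ∀ (A B : Subgroup G) [A.Normal] [B.Normal], IsChiefFactor A B →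
      (∃ n : ℕ, B.relIndex A = p ^ n) → f p (G ⧸ sectionCentralizer A B)

/-- `f` is an integrated local definition of `C`: each `f p` (`p` prime) is a (possibly empty)
formation, `C = loc(f)`, and `f p ⊆ loc(f)` for each prime `p`. -/
structure IsIntegratedLocalDefinition (f : ℕ → GroupClass.{u}) (C : GroupClass.{u}) : Prop where
  formation : ∀ p : ℕ, p.Prime → IsFormation (f p)
  mem_iff : ∀ (G : Type u) [Group G], C G ↔ Loc f G
  integrated : ∀ p : ℕ, p.Prime → ∀ (G : Type u) [Group G], f p G → Loc f G

/-- The cone over `G` with respect to a class `C` of groups: pairs of a group `X` in `C` and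
an epimorphism `ε : X → G`. -/
structure FormationCone (C : GroupClass.{u}) (G : Type u) [Group G] where
  X : Type u
  [group : Group X]
  mem : C X
  ε : X →* G
  surjective : Function.Surjective ε

attribute [instance] FormationCone.group

section Modules

variable {F : Type u} [Field F] {G : Type u} [Group G] {V : Type u} [AddCommGroup V] [Module F V]

/-- The subquotient `W / U` of a representation, for subrepresentations `U ≤ W`. (In general this
is `W / (U ∩ W)`.) -/
def subquotientRep {ρ : Representation F G V} (U W : Subrepresentation ρ) :
    Representation F G
      (W.toSubmodule ⧸ U.toSubmodule.comap W.toSubmodule.subtype) :=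
  W.toRepresentation.quotient (U.toSubmodule.comap W.toSubmodule.subtype)
    (fun g _ hw => U.apply_mem_toSubmodule g hw)

/-- An irreducible representation `σ` of `G` over a field of characteristic `p` is central, with
respect to `f`, if `G / C_G(σ)` lies in `f p`; here `C_G(σ)` is the kernel of `σ`. -/
def IsCentralRep (f : ℕ → GroupClass.{u}) (p : ℕ) (σ : Representation F G V) : Prop :=
  σ.IsIrreducible ∧ f p (G ⧸ MonoidHom.ker σ)

/-- An irreducible representation is eccentric if it is not central. -/
def IsEccentricRep (f : ℕ → GroupClass.{u}) (p : ℕ) (σ : Representation F G V) : Prop :=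
  σ.IsIrreducible ∧ ¬ IsCentralRep f p σ

/-- A representation is hypereccentric if each of its composition factors is eccentric. The
composition factors are the subquotients `W / U` where `W` covers `U` in the lattice of
subrepresentations. -/
def IsHypereccentric (f : ℕ → GroupClass.{u}) (p : ℕ) (ρ : Representation F G V) : Prop :=
  ∀ U W : Subrepresentation ρ, U ⋖ W → IsEccentricRep f p (subquotientRep U W)

end Modules

/-! ### Chief factors, their centralisers, and a criterion for lying in `Loc f` -/

section Groups

variable {G : Type u} [Group G]

/-! Let P(U) say that H¹(X, V/U) = 0 for every X in the cone over G (`VanishesOnCone`). The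
hypothesis is P(⊥), and P climbs through composition factors. Let U ⋖ W and suppose P(U).

The factor W/U cannot be central (`VanishesOnCone.not_central`). Otherwise the split extension of G
by a finite minimal invariant subgroup of W/U lies in the formation, since its only new chief factor
is central (`Loc.of_minimal_normal`). Projection to the module coordinate is a cocycle that is
nonzero at an element acting trivially, so it is not a coboundary, against P(U).

Since W/U is eccentric, every cocycle X → V/W lifts to V/U (`exists_cocycle_lift`). The pairs (m, x)
with m lying over the value at x form a group mapping onto X. In a minimal finite subgroup Y still
mapping onto X, the kernel lies in the Frattini subgroup, so Y is in the formation by saturation. A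
nontrivial kernel would contain a p-chief factor of Y with the same centraliser as W/U, making W/U
central; so Y is the graph of a lift. By P(U) the lift is a coboundary, whence P(W)
(`VanishesOnCone.of_covBy`). Finite length gives P everywhere, so no composition factor is central.
-/

theorem mem_sectionCentralizer {A B : Subgroup G} [B.Normal] {g : G} :
    g ∈ sectionCentralizer A B ↔ ∀ a ∈ A, a * g * a⁻¹ * g⁻¹ ∈ B := by
  unfold sectionCentralizer
  rw [Subgroup.mem_comap, Subgroup.mem_centralizer_iff]
  constructor
  · intro h a ha
    have := h (QuotientGroup.mk' B a) (Subgroup.mem_map_of_mem _ ha)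
    rw [← QuotientGroup.eq_one_iff]
    simp only [QuotientGroup.mk'_apply] at this
    simp [this]
  · rintro h _ ⟨a, ha, rfl⟩
    have := (QuotientGroup.eq_one_iff _).2 (h a ha)
    simp only [QuotientGroup.mk_mul, QuotientGroup.mk_inv] at this
    rw [mul_inv_eq_one, mul_inv_eq_iff_eq_mul] at this
    simpa using this

theorem mem_sectionCentralizer_bot {A : Subgroup G} {g : G} :
    g ∈ sectionCentralizer A (⊥ : Subgroup G) ↔ ∀ a ∈ A, g * a * g⁻¹ = a := by
  rw [mem_sectionCentralizer]
  refine forall₂_congr fun a _ => ?_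
  rw [Subgroup.mem_bot, mul_inv_eq_one, mul_inv_eq_iff_eq_mul, mul_inv_eq_iff_eq_mul, eq_comm]

theorem GroupClass.quotient_congr (C : GroupClass.{u}) (K L : Subgroup G) [K.Normal]
    [L.Normal] (h : L = K) (hK : C (G ⧸ K)) : C (G ⧸ L) := by
  subst h
  exact hK

namespace IsFormation

variable {C : GroupClass.{u}}

theorem of_surjective (hC : IsFormation C) {X Y : Type u} [Group X] [Group Y] (φ : X →* Y)
    (hφ : Function.Surjective φ) (hX : C X) : C Y :=
  hC.iso _ _ (QuotientGroup.quotientKerEquivOfSurjective φ hφ) (hC.quotient X φ.ker hX)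

theorem quotient_comap_iff (hC : IsFormation C) {X Y : Type u} [Group X] [Group Y] (φ : X →* Y)
    (hφ : Function.Surjective φ) (K : Subgroup Y) [K.Normal] (L : Subgroup X) [L.Normal]
    (hL : L = K.comap φ) : C (X ⧸ L) ↔ C (Y ⧸ K) := by
  let ψ : X →* Y ⧸ K := (QuotientGroup.mk' K).comp φ
  have hψ : Function.Surjective ψ := (QuotientGroup.mk'_surjective K).comp hφ
  have hk : ψ.ker = L := by
    rw [hL]
    ext x
    simp [ψ, MonoidHom.mem_ker]
  subst hk
  have e := QuotientGroup.quotientKerEquivOfSurjective ψ hψ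
  exact ⟨hC.iso _ _ e, hC.iso _ _ e.symm⟩

end IsFormation

section ChiefFactors

variable {N H K : Subgroup G} [N.Normal]

/-- The condition `N ⊓ H ≤ K` means that reduction modulo `N` collapses nothing in `H / K`. Not
requiring `N ≤ K` allows arbitrary chief factors to be treated without Jordan–Hölder. -/
theorem IsChiefFactor.map_mk' [H.Normal] (h : IsChiefFactor H K) (hN : N ⊓ H ≤ K) :
    IsChiefFactor (H.map (QuotientGroup.mk' N)) (K.map (QuotientGroup.mk' N)) := by
  have key : ∀ x ∈ H, QuotientGroup.mk' N x ∈ K.map (QuotientGroup.mk' N) → x ∈ K := by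
    rintro x hx ⟨k, hk, e⟩
    have h1 : k⁻¹ * x ∈ N := by
      rw [← QuotientGroup.eq]
      exact e
    have h2 : k⁻¹ * x ∈ K := hN ⟨h1, H.mul_mem (H.inv_mem (h.lt.le hk)) hx⟩
    simpa using K.mul_mem hk h2
  have s := QuotientGroup.mk'_surjective N
  refine ⟨h.normal_top.map _ s, h.normal_bot.map _ s, ?_, ?_⟩
  · refine lt_of_le_not_ge (Subgroup.map_mono h.lt.le) fun hle => h.lt.not_ge fun x hx => ?_
    exact key x hx (hle (Subgroup.mem_map_of_mem _ hx))
  · intro L hL hKL hLH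
    have hn : (L.comap (QuotientGroup.mk' N) ⊓ H).Normal := inferInstance
    rcases h.eq_or_eq _ hn (le_inf (Subgroup.map_le_iff_le_comap.1 hKL) h.lt.le) inf_le_right
      with e | e
    · left
      refine le_antisymm (fun y hy => ?_) hKL
      obtain ⟨x, hx, rfl⟩ := hLH hy
      exact Subgroup.mem_map_of_mem _ (e ▸ (⟨hy, hx⟩ : x ∈ L.comap (QuotientGroup.mk' N) ⊓ H))
    · right
      refine le_antisymm hLH (Subgroup.map_le_iff_le_comap.2 ?_)
      rw [← e]
      exact inf_le_left

theorem relIndex_map_mk' [K.Normal] (hKH : K ≤ H) (hN : N ⊓ H ≤ K) :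
    (K.map (QuotientGroup.mk' N)).relIndex (H.map (QuotientGroup.mk' N)) = K.relIndex H := by
  have e1 : H ⊔ N = H ⊔ (K ⊔ N) := by rw [← sup_assoc, sup_eq_left.2 hKH]
  have e2 : (K ⊔ N) ⊓ H = K := by
    refine le_antisymm ?_ (le_inf le_sup_left hKH)
    rintro x ⟨hx, hxH⟩
    obtain ⟨k, hk, n, hn, rfl⟩ := Subgroup.mem_sup_of_normal_right.1 hx
    exact K.mul_mem hk (hN ⟨hn, (Subgroup.mul_mem_cancel_left H (hKH hk)).1 hxH⟩)
  rw [Subgroup.relIndex_map_map, QuotientGroup.ker_mk', e1, Subgroup.relIndex_sup_right,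
    ← Subgroup.inf_relIndex_right, e2]

theorem sectionCentralizer_eq_comap_map_mk' [H.Normal] [K.Normal] (hKH : K ≤ H) (hN : N ⊓ H ≤ K)
    [(H.map (QuotientGroup.mk' N)).Normal] [(K.map (QuotientGroup.mk' N)).Normal] :
    sectionCentralizer H K = (sectionCentralizer (H.map (QuotientGroup.mk' N))
      (K.map (QuotientGroup.mk' N))).comap (QuotientGroup.mk' N) := by
  ext g
  rw [Subgroup.mem_comap, mem_sectionCentralizer, mem_sectionCentralizer]
  constructor
  · rintro h _ ⟨a, ha, rfl⟩
    exact ⟨_, h a ha, by simp only [map_mul, map_inv]⟩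
  · intro h a ha
    obtain ⟨k, hk, e⟩ := h _ (Subgroup.mem_map_of_mem _ ha)
    simp only [← map_mul, ← map_inv] at e
    have h1 : k⁻¹ * (a * g * a⁻¹ * g⁻¹) ∈ N := by
      rw [← QuotientGroup.eq]
      exact e
    have h3 : a * g * a⁻¹ * g⁻¹ ∈ H := by
      rw [mul_assoc, mul_assoc, ← mul_assoc g]
      exact H.mul_mem ha (Subgroup.Normal.conj_mem ‹_› _ (H.inv_mem ha) g)
    have h2 := hN ⟨h1, H.mul_mem (H.inv_mem (hKH hk)) h3⟩
    simpa using K.mul_mem hk h2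

/-- The complementary case to `IsChiefFactor.map_mk'`: minimality of `N` puts it inside `H`, and
then `H / K` is a copy of `N`. -/
theorem IsChiefFactor.eq_sup_of_not_le [H.Normal] [K.Normal] (h : IsChiefFactor H K) (hmin : IsChiefFactor N ⊥)
    (hN : ¬ N ⊓ H ≤ K) : H = N ⊔ K ∧ N ⊓ K = ⊥ := by
  have h1 : N ≤ H := by
    rcases hmin.eq_or_eq (N ⊓ H) inferInstance bot_le inf_le_left with e | e
    · exact absurd (e ▸ bot_le) hN
    · exact inf_eq_left.1 e
  constructor
  · rcases h.eq_or_eq (N ⊔ K) inferInstance le_sup_right (sup_le h1 h.lt.le) with e | e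
    · exact absurd (inf_le_left.trans (sup_eq_right.1 e)) hN
    · exact e.symm
  · rcases hmin.eq_or_eq (N ⊓ K) inferInstance bot_le inf_le_left with e | e
    · exact e
    · exact absurd (inf_le_left.trans (inf_eq_left.1 e)) hN

theorem sectionCentralizer_sup [K.Normal] (hN : N ⊓ K = ⊥) :
    sectionCentralizer (N ⊔ K) K = sectionCentralizer N ⊥ := by
  ext g
  rw [mem_sectionCentralizer, mem_sectionCentralizer]
  constructor
  · intro h n hn
    rw [← hN]
    refine ⟨?_, h n (Subgroup.mem_sup_left hn)⟩
    rw [mul_assoc, mul_assoc, ← mul_assoc g]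
    exact N.mul_mem hn (Subgroup.Normal.conj_mem ‹_› _ (N.inv_mem hn) g)
  · intro h a ha
    obtain ⟨n, hn, k, hk, rfl⟩ := Subgroup.mem_sup_of_normal_right.1 ha
    have e : n * g * n⁻¹ * g⁻¹ = 1 := h n hn
    -- The commutator of `n * k` with `g` is a conjugate of that of `k`, which lies in `K`, times
    -- that of `n`, which is trivial.
    have e2 : n * k * g * (n * k)⁻¹ * g⁻¹ =
        n * (k * (g * k⁻¹ * g⁻¹)) * n⁻¹ * (n * g * n⁻¹ * g⁻¹) := by group
    rw [e2, e, mul_one]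
    exact Subgroup.Normal.conj_mem ‹_› _ (K.mul_mem hk
      (Subgroup.Normal.conj_mem ‹_› _ (K.inv_mem hk) g)) n

end ChiefFactors

/-- A finite group lies in `loc(f)` if it has a minimal normal `p`-subgroup which is central with
respect to `f` and whose quotient lies in `loc(f)`. -/
theorem Loc.of_minimal_normal {f : ℕ → GroupClass.{u}} (hf : ∀ q, q.Prime → IsFormation (f q))
    [Finite G] {p m : ℕ} (hp : p.Prime) {N : Subgroup G} [N.Normal]
    (hN : IsChiefFactor N ⊥) (hcard : Nat.card N = p ^ m)
    (hcent : f p (G ⧸ sectionCentralizer N ⊥)) (hquot : Loc f (G ⧸ N)) : Loc f G := by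
  refine ⟨‹_›, ?_, ?_⟩
  · have : Fact p.Prime := ⟨hp⟩
    have := (IsPGroup.of_card hcard).isNilpotent
    have := hquot.2.1
    exact Group.isSolvable_of_ker_le_range N.subtype (QuotientGroup.mk' N) (by simp)
  · rintro q hq H K hHn hKn hHK ⟨n, hn⟩
    by_cases hle : N ⊓ H ≤ K
    · have hc := hHK.map_mk' hle
      have := hc.normal_top
      have := hc.normal_bot
      have h1 := hquot.2.2 q hq _ _ hc ⟨n, (relIndex_map_mk' hHK.lt.le hle).trans hn⟩
      exact ((hf q hq).quotient_comap_iff _ (QuotientGroup.mk'_surjective N) _ _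
        (sectionCentralizer_eq_comap_map_mk' hHK.lt.le hle)).2 h1
    · obtain ⟨rfl, hbot⟩ := hHK.eq_sup_of_not_le hN hle
      rw [Subgroup.relIndex_sup_right, ← Subgroup.inf_relIndex_right, inf_comm, hbot,
        Subgroup.relIndex_bot_left, hcard] at hn
      -- Here `H / K` has the order of `N`; nontriviality of `N` is what forces the two primes to
      -- agree.
      have hm : m ≠ 0 := by
        rintro rfl
        rw [pow_zero, Subgroup.card_eq_one] at hcard
        exact hN.lt.ne hcard.symm
      have hqp : p = q := (Nat.prime_dvd_prime_iff_eq hp hq).1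
        (hp.dvd_of_dvd_pow (hn ▸ dvd_pow_self p hm))
      subst hqp
      exact GroupClass.quotient_congr (f p) _ _ (sectionCentralizer_sup hbot) hcent

end Groups

/-! ### Split extensions and their finite subgroups -/

section SemidirectProducts

variable {F : Type u} [Field F] {X : Type u} [Group X] {M : Type u} [AddCommGroup M] [Module F M]

/-- The action of a group on the multiplicative form of the additive group of a
representation. -/
def Representation.toMulAut (σ : Representation F X M) : X →* MulAut (Multiplicative M) where
  toFun g :=
    { toFun := fun m => Multiplicative.ofAdd (σ g m.toAdd)
      invFun := fun m => Multiplicative.ofAdd (σ g⁻¹ m.toAdd)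
      left_inv := fun m => by simp
      right_inv := fun m => by simp
      map_mul' := fun m n => by simp }
  map_one' := by ext; simp
  map_mul' g h := by ext; simp

/-- The semidirect product of a representation space with the group acting on it. -/
abbrev Representation.Split (σ : Representation F X M) : Type u :=
  Multiplicative M ⋊[σ.toMulAut] X

namespace Representation

variable {σ : Representation F X M}

@[simp]
theorem toAdd_toMulAut_apply (g : X) (m : Multiplicative M) :
    (σ.toMulAut g m).toAdd = σ g m.toAdd := rfl

namespace Split

theorem toAdd_left_mul (y z : σ.Split) :
    (y * z).left.toAdd = y.left.toAdd + σ y.right z.left.toAdd := by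
  simp

theorem toAdd_left_inv (y : σ.Split) :
    (y⁻¹).left.toAdd = - σ y.right⁻¹ y.left.toAdd := by
  simp
  rfl

theorem eq_inl {y : σ.Split} (hy : y.right = 1) : y = SemidirectProduct.inl y.left := by
  ext <;> simp [hy]

theorem conj_inl (y : σ.Split) (m : M) :
    y * SemidirectProduct.inl (Multiplicative.ofAdd m) * y⁻¹ =
      SemidirectProduct.inl (Multiplicative.ofAdd (σ y.right m)) := by
  refine SemidirectProduct.ext ?_ (by simp)
  apply Multiplicative.toAdd.injective
  simp

theorem pow_char_eq_one (p : ℕ) [CharP F p] {y : σ.Split} (hy : y.right = 1) : y ^ p = 1 := by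
  have h : y.left ^ p = 1 := by
    apply Multiplicative.toAdd.injective
    rw [toAdd_pow, toAdd_one, ← Nat.cast_smul_eq_nsmul F, CharP.cast_eq_zero, zero_smul]
  rw [eq_inl hy, ← map_pow, h, map_one]

/-- The part inside the representation space of a subgroup of a subgroup of the split
extension. -/
def leftPart {Y : Subgroup σ.Split} (A : Subgroup Y) : AddSubgroup M :=
  Subgroup.toAddSubgroup' ((A.map Y.subtype).comap SemidirectProduct.inl)

theorem mem_leftPart {Y : Subgroup σ.Split} {A : Subgroup Y} {m : M} :
    m ∈ leftPart A ↔ ∃ a ∈ A, (a : σ.Split) = SemidirectProduct.inl (Multiplicative.ofAdd m) :=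
  Iff.rfl

variable {Y : Subgroup σ.Split} {A : Subgroup Y}

theorem toAdd_left_mem_leftPart {a : Y} (ha : a ∈ A) (h : (a : σ.Split).right = 1) :
    (a : σ.Split).left.toAdd ∈ leftPart A :=
  mem_leftPart.2 ⟨a, ha, eq_inl h⟩

theorem apply_mem_leftPart [hA : A.Normal] (hY : ∀ g, ∃ y ∈ Y, y.right = g) (g : X) {m : M}
    (hm : m ∈ leftPart A) : σ g m ∈ leftPart A := by
  obtain ⟨a, ha, e⟩ := mem_leftPart.1 hm
  obtain ⟨y, hy, rfl⟩ := hY g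
  refine mem_leftPart.2 ⟨_, hA.conj_mem a ha ⟨y, hy⟩, ?_⟩
  rw [← conj_inl, ← e]
  rfl

theorem mem_sectionCentralizer_bot_iff [A.Normal] (h : ∀ a ∈ A, (a : σ.Split).right = 1) (y : Y) :
    y ∈ sectionCentralizer A ⊥ ↔ ∀ m ∈ leftPart A, σ (y : σ.Split).right m = m := by
  rw [mem_sectionCentralizer_bot]
  constructor
  · intro hy m hm
    obtain ⟨a, ha, e⟩ := mem_leftPart.1 hm
    have h1 := congrArg Subtype.val (hy a ha)
    simp only [Subgroup.coe_mul, Subgroup.coe_inv, e, conj_inl] at h1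
    exact Multiplicative.ofAdd.injective (SemidirectProduct.inl_injective h1)
  · intro hy a ha
    have h1 := hy _ (toAdd_left_mem_leftPart ha (h a ha))
    apply Subtype.ext
    simp only [Subgroup.coe_mul, Subgroup.coe_inv]
    have e := eq_inl (h a ha)
    conv_rhs => rw [e]
    conv_lhs => rw [e]
    have h2 := conj_inl (y : σ.Split) (a : σ.Split).left.toAdd
    rw [h1] at h2
    exact h2

/-- `A` gives only an additive subgroup of `E`, perhaps not an `F`-subspace. Its `F`-span is
invariant and nonzero, hence all of `E`, and a linear map fixes a set pointwise exactly when it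
fixes its span. -/
theorem sectionCentralizer_eq_comap [A.Normal] {E : Submodule F M}
    (hE : ∀ B : Submodule F M, (∀ g, ∀ m ∈ B, σ g m ∈ B) → B ≤ E → B ≠ ⊥ → B = E)
    (hY : ∀ g, ∃ y ∈ Y, y.right = g) (hA : A ≠ ⊥)
    (hAE : ∀ a ∈ A, (a : σ.Split).right = 1 ∧ (a : σ.Split).left.toAdd ∈ E)
    {N : Subgroup X} (hN : ∀ g, g ∈ N ↔ ∀ m ∈ E, σ g m = m) :
    sectionCentralizer A ⊥ = N.comap (SemidirectProduct.rightHom.comp Y.subtype) := by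
  have hle : ∀ m ∈ leftPart A, m ∈ E := by
    intro m hm
    obtain ⟨a, ha, e⟩ := mem_leftPart.1 hm
    have := (hAE a ha).2
    rwa [e] at this
  have hspan : Submodule.span F (leftPart A : Set M) = E := by
    refine hE _ (fun g => ?_) (Submodule.span_le.2 hle) fun h0 => hA ?_
    · change Submodule.span F (leftPart A : Set M) ≤
        (Submodule.span F (leftPart A : Set M)).comap (σ g)
      exact Submodule.span_le.2 fun m hm => Submodule.subset_span (apply_mem_leftPart hY g hm)
    · rw [Subgroup.eq_bot_iff_forall]
      intro a ha
      have h1 := Submodule.span_eq_bot.1 h0 _ (toAdd_left_mem_leftPart ha (hAE a ha).1)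
      apply Subtype.ext
      rw [eq_inl (hAE a ha).1, show (a : σ.Split).left = 1 from h1, map_one]
      rfl
  ext y
  rw [mem_sectionCentralizer_bot_iff fun a ha => (hAE a ha).1, Subgroup.mem_comap, hN]
  constructor
  · intro h
    change E ≤ LinearMap.eqLocus (σ (y : σ.Split).right) LinearMap.id
    rw [← hspan]
    exact Submodule.span_le.2 h
  · exact fun h m hm => h m (hle m hm)

end Split

/-- `F` may be infinite, while formations contain only finite groups. In characteristic `p` the
additive group generated by the finitely many translates of `S` is finitely generated of exponent
dividing `p`, hence finite. -/
theorem exists_finite_invariant [Finite X] (σ : Representation F X M) (p : ℕ) [CharP F p]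
    (hp : p ≠ 0) {S : Set M} (hS : S.Finite) :
    ∃ M₀ : AddSubgroup M, Finite M₀ ∧ S ⊆ M₀ ∧ (∀ g, ∀ m ∈ M₀, σ g m ∈ M₀) ∧
      ∀ B : Submodule F M, (∀ g, ∀ m ∈ B, σ g m ∈ B) → S ⊆ B → ∀ m ∈ M₀, m ∈ B := by
  have hfin : (⋃ g, σ g '' S).Finite := Set.finite_iUnion fun g => hS.image _
  refine ⟨AddSubgroup.closure (⋃ g, σ g '' S), ?_, ?_, ?_, ?_⟩
  · have : AddGroup.FG (AddSubgroup.closure (⋃ g, σ g '' S)) :=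
      (AddGroup.fg_iff_addSubgroup_fg _).2 ⟨hfin.toFinset, by simp⟩
    refine AddCommGroup.finite_of_fg_isAddTorsion _ fun m => ?_
    refine isOfFinAddOrder_iff_nsmul_eq_zero.2 ⟨p, Nat.pos_of_ne_zero hp, Subtype.ext ?_⟩
    rw [AddSubgroup.coe_nsmul, ← Nat.cast_smul_eq_nsmul F, CharP.cast_eq_zero, zero_smul]
    rfl
  · intro m hm
    exact AddSubgroup.subset_closure (Set.mem_iUnion.2 ⟨1, m, hm, by simp⟩)
  · intro g m hm
    have : AddSubgroup.closure (⋃ g, σ g '' S) ≤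
        (AddSubgroup.closure (⋃ g, σ g '' S)).comap (σ g).toAddMonoidHom := by
      rw [AddSubgroup.closure_le]
      intro x hx
      obtain ⟨h, s, hs, rfl⟩ := Set.mem_iUnion.1 hx
      exact AddSubgroup.subset_closure (Set.mem_iUnion.2 ⟨g * h, s, hs, by simp⟩)
    exact this hm
  · intro B hB hSB
    change AddSubgroup.closure (⋃ g, σ g '' S) ≤ B.toAddSubgroup
    rw [AddSubgroup.closure_le]
    intro x hx
    obtain ⟨h, s, hs, rfl⟩ := Set.mem_iUnion.1 hx
    exact hB h s (hSB hs)

/-- The subgroup of the split extension of those elements whose left part lies in a given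
invariant subgroup and is congruent to `c x` modulo `E`. -/
def cocycleSubgroup (σ : Representation F X M) (M₀ : AddSubgroup M)
    (hM₀ : ∀ g, ∀ m ∈ M₀, σ g m ∈ M₀) (E : Submodule F M) (hE : ∀ g, ∀ m ∈ E, σ g m ∈ E)
    (c : X → M) (hc : ∀ x y, c (x * y) - c x - σ x (c y) ∈ E) : Subgroup σ.Split where
  carrier := {y | y.left.toAdd ∈ M₀ ∧ y.left.toAdd - c y.right ∈ E}
  mul_mem' := by
    rintro y z ⟨hy, hy'⟩ ⟨hz, hz'⟩
    refine ⟨?_, ?_⟩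
    · rw [Split.toAdd_left_mul]
      exact M₀.add_mem hy (hM₀ _ _ hz)
    · rw [Split.toAdd_left_mul, SemidirectProduct.mul_right]
      have := E.sub_mem (E.add_mem hy' (hE y.right _ hz')) (hc y.right z.right)
      rw [map_sub] at this
      convert this using 1
      abel
  one_mem' := by
    refine ⟨M₀.zero_mem, ?_⟩
    have := hc 1 1
    simpa using this
  inv_mem' := by
    rintro y ⟨hy, hy'⟩
    refine ⟨?_, ?_⟩
    · rw [Split.toAdd_left_inv]
      exact M₀.neg_mem (hM₀ _ _ hy)
    · rw [Split.toAdd_left_inv, SemidirectProduct.inv_right]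
      have h1 : c 1 ∈ E := by simpa using hc 1 1
      -- The cocycle condition at an inverse pair expresses `c` of the inverse modulo `E`.
      have h2 := hc y.right⁻¹ y.right
      rw [inv_mul_cancel] at h2
      have := E.sub_mem (E.sub_mem h2 h1) (hE y.right⁻¹ _ hy')
      rw [map_sub] at this
      convert this using 1
      abel

theorem finite_cocycleSubgroup [Finite X] (σ : Representation F X M) (M₀ : AddSubgroup M)
    [Finite M₀] (hM₀ : ∀ g, ∀ m ∈ M₀, σ g m ∈ M₀) (E : Submodule F M)
    (hE : ∀ g, ∀ m ∈ E, σ g m ∈ E)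
    (c : X → M) (hc : ∀ x y, c (x * y) - c x - σ x (c y) ∈ E) :
    Finite (σ.cocycleSubgroup M₀ hM₀ E hE c hc) := by
  refine Finite.of_injective (β := M₀ × X)
    (fun y => (⟨y.1.left.toAdd, y.2.1⟩, y.1.right)) fun y z h => ?_
  simp only [Prod.mk.injEq, Subtype.mk.injEq] at h
  exact Subtype.ext (SemidirectProduct.ext (Multiplicative.toAdd.injective h.1) h.2)

end Representation

end SemidirectProducts

/-! ### Saturation kills eccentric extensions; central split extensions stay in the formation -/

section Extensions

open Representation

variable {C : GroupClass.{u}} {f : ℕ → GroupClass.{u}} {p : ℕ} {F : Type u} [Field F]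
  {X : Type u} [Group X] {M : Type u} [AddCommGroup M] [Module F M] {σ : Representation F X M}

theorem exists_chiefFactor_bot_le {Y : Type u} [Group Y] [Finite Y] (D : Subgroup Y) [D.Normal]
    (hD : D ≠ ⊥) : ∃ A : Subgroup Y, IsChiefFactor A ⊥ ∧ A ≤ D := by
  obtain ⟨A, ⟨hAn, hAD, hA⟩, hmin⟩ := (measure fun A : Subgroup Y => Nat.card A).wf.has_min
    {A | A.Normal ∧ A ≤ D ∧ A ≠ ⊥} ⟨D, ‹_›, le_rfl, hD⟩
  refine ⟨A, ⟨hAn, inferInstance, bot_lt_iff_ne_bot.2 hA, fun L hL _ hLA => ?_⟩, hAD⟩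
  by_cases h : L = ⊥
  · exact Or.inl h
  · exact Or.inr (Subgroup.eq_of_le_of_card_ge hLA (not_lt.1 (hmin L ⟨hL, hLA.trans hAD, h⟩)))

theorem Representation.Split.exists_card_eq_pow (hp : p.Prime) [CharP F p] {Y : Subgroup σ.Split}
    {A : Subgroup Y} [Finite A]
    (hA : ∀ a ∈ A, (a : σ.Split).right = 1) : ∃ n, Nat.card A = p ^ n := by
  have : Fact p.Prime := ⟨hp⟩
  refine IsPGroup.iff_card.1 fun a => ⟨1, ?_⟩
  rw [pow_one]
  apply Subtype.ext
  apply Subtype.ext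
  exact pow_char_eq_one (F := F) p (hA a a.2)

/-- A subgroup of the split extension that is minimal among the finite subgroups projecting onto
the complement, has its unipotent part inside its Frattini subgroup. -/
theorem Representation.Split.ker_le_frattini {Y : Subgroup σ.Split} [Finite Y]
    (hY : ∀ g, ∃ y ∈ Y, y.right = g)
    (hmin : ∀ Z : Subgroup σ.Split, Z ≤ Y → (∀ g, ∃ y ∈ Z, y.right = g) → Z = Y) :
    (SemidirectProduct.rightHom.comp Y.subtype).ker ≤ frattini Y := by
  refine le_iInf₂ fun H hH => ?_
  by_contra hle
  -- A maximal subgroup missing part of the kernel supplements it, so it still projects onto `X`,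
  -- against the minimality of `Y`.
  have htop : H ⊔ (SemidirectProduct.rightHom.comp Y.subtype).ker = ⊤ :=
    hH.2 _ (left_lt_sup.2 hle)
  refine hH.1 ?_
  have h1 := hmin (H.map Y.subtype) (Subgroup.map_subtype_le H) fun g => by
    obtain ⟨y, hy, rfl⟩ := hY g
    have hy' : (⟨y, hy⟩ : Y) ∈ H ⊔ (SemidirectProduct.rightHom.comp Y.subtype).ker :=
      htop ▸ Subgroup.mem_top _
    obtain ⟨h, hh, k, hk, e⟩ := Subgroup.mem_sup_of_normal_right.1 hy'
    refine ⟨h, Subgroup.mem_map_of_mem _ hh, ?_⟩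
    have hk' : (k : σ.Split).right = 1 := hk
    have e' := congrArg (fun z : Y => (z : σ.Split).right) e
    simpa [hk'] using e'
  rw [eq_top_iff]
  intro y _
  have : (y : σ.Split) ∈ H.map Y.subtype := by rw [h1]; exact y.2
  obtain ⟨h, hh, e⟩ := this
  rwa [← Subtype.ext e]

/-- A map into a module that is a cocycle modulo an eccentric irreducible
submodule `E` is congruent to a cocycle modulo `E`. -/
theorem exists_cocycle_lift (hC : IsSaturatedFormation C) (hf : IsIntegratedLocalDefinition f C)
    (hp : p.Prime) [CharP F p] (hX : C X) {E : Submodule F M} (hE : ∀ g, ∀ m ∈ E, σ g m ∈ E)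
    (hirr : ∀ B : Submodule F M, (∀ g, ∀ m ∈ B, σ g m ∈ B) → B ≤ E → B ≠ ⊥ → B = E)
    {N : Subgroup X} [N.Normal] (hN : ∀ g, g ∈ N ↔ ∀ m ∈ E, σ g m = m) (hecc : ¬ f p (X ⧸ N))
    (c : X → M) (hc : ∀ x y, c (x * y) - c x - σ x (c y) ∈ E) :
    ∃ d : X → M, (∀ x, d x - c x ∈ E) ∧ ∀ x y, d (x * y) = d x + σ x (d y) := by
  have : Finite X := hC.finite X hX
  obtain ⟨M₀, _, hcM, hM₀, -⟩ := σ.exists_finite_invariant p hp.ne_zero (Set.finite_range c)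
  have := σ.finite_cocycleSubgroup M₀ hM₀ E hE c hc
  obtain ⟨Y, ⟨hYle, hY⟩, hYmin⟩ := (measure fun Y : Subgroup σ.Split => Nat.card Y).wf.has_min
    {Y | Y ≤ σ.cocycleSubgroup M₀ hM₀ E hE c hc ∧ ∀ g, ∃ y ∈ Y, y.right = g}
    ⟨_, le_rfl, fun g => ⟨⟨Multiplicative.ofAdd (c g), g⟩, ⟨hcM ⟨g, rfl⟩, by simp⟩, rfl⟩⟩
  have : Finite Y := Finite.of_injective _ (Subgroup.inclusion_injective hYle)
  have hc1 : c 1 ∈ E := by simpa using hc 1 1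
  set π : Y →* X := SemidirectProduct.rightHom.comp Y.subtype
  have hπs : Function.Surjective π := fun g => by
    obtain ⟨y, hy, e⟩ := hY g
    exact ⟨⟨y, hy⟩, e⟩
  have hfr : π.ker ≤ frattini Y := Split.ker_le_frattini hY fun Z hZ hZs =>
    Subgroup.eq_of_le_of_card_ge hZ (not_lt.1 (hYmin Z ⟨hZ.trans hYle, hZs⟩))
  -- `Y / Φ(Y)` is a quotient of `Y / ker π ≅ X`, so saturation applies.
  have hYC : C Y := by
    refine hC.saturated Y ?_
    have h1 : C (Y ⧸ π.ker) :=
      hC.iso _ _ (QuotientGroup.quotientKerEquivOfSurjective π hπs).symm hX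
    refine hC.of_surjective (QuotientGroup.map _ _ (MonoidHom.id Y) hfr) ?_ h1
    exact QuotientGroup.map_surjective_of_surjective _ _ _
      (QuotientGroup.mk_surjective.comp Function.surjective_id) hfr
  -- A minimal normal subgroup inside the kernel is a `p`-chief factor of `Y` centralised exactly by
  -- the preimage of `N`, so it would put `X ⧸ N` into `f p`.
  have hker : π.ker = ⊥ := by
    by_contra hne
    obtain ⟨A, hA, hAle⟩ := exists_chiefFactor_bot_le _ hne
    have := hA.normal_top
    have hr : ∀ a ∈ A, (a : σ.Split).right = 1 := fun a ha => hAle ha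
    obtain ⟨n, hn⟩ := Split.exists_card_eq_pow hp hr
    have h1 := ((hf.mem_iff Y).1 hYC).2.2 p hp A ⊥ hA ⟨n, by rwa [Subgroup.relIndex_bot_left]⟩
    refine hecc (((hf.formation p hp).quotient_comap_iff π hπs N _ ?_).1 h1)
    refine Split.sectionCentralizer_eq_comap hirr hY hA.lt.ne' (fun a ha => ⟨hr a ha, ?_⟩) hN
    have h2 := (hYle a.2).2
    rw [hr a ha] at h2
    simpa using E.add_mem h2 hc1
  have hinj : Function.Injective π := (MonoidHom.ker_eq_bot_iff π).1 hker
  -- `Y` is now the graph of a function on `X`, and closure under products is the cocycle identity.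
  let e : Y ≃* X := MulEquiv.ofBijective π ⟨hinj, hπs⟩
  have he : ∀ x, (e.symm x : σ.Split).right = x := fun x => e.apply_symm_apply x
  refine ⟨fun x => (e.symm x : σ.Split).left.toAdd, fun x => ?_, fun x y => ?_⟩
  · have := (hYle (e.symm x).2).2
    rwa [he] at this
  · beta_reduce
    rw [map_mul, Subgroup.coe_mul, Split.toAdd_left_mul, he]

/-- The split extension by a finite part of a central irreducible submodule. -/
theorem exists_split_extension_mem (hC : IsSaturatedFormation C)
    (hf : IsIntegratedLocalDefinition f C)
    (hp : p.Prime) [CharP F p] (hX : C X) {E : Submodule F M} (hE : ∀ g, ∀ m ∈ E, σ g m ∈ E)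
    (hirr : ∀ B : Submodule F M, (∀ g, ∀ m ∈ B, σ g m ∈ B) → B ≤ E → B ≠ ⊥ → B = E)
    (hne : E ≠ ⊥)
    {N : Subgroup X} [N.Normal] (hN : ∀ g, g ∈ N ↔ ∀ m ∈ E, σ g m = m) (hcent : f p (X ⧸ N)) :
    ∃ Y : Subgroup σ.Split, C Y ∧ (∀ g, ∃ y ∈ Y, y.right = g) ∧ (∀ y ∈ Y, y.left.toAdd ∈ E) ∧
      ∃ y ∈ Y, y.right = 1 ∧ y.left.toAdd ≠ 0 := by
  have : Finite X := hC.finite X hX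
  obtain ⟨w, hwE, hw⟩ := Submodule.exists_mem_ne_zero_of_ne_bot hne
  obtain ⟨M₁, hM₁f, hwM₁, hM₁, hM₁E⟩ :=
    σ.exists_finite_invariant p hp.ne_zero (Set.finite_singleton w)
  -- Minimality of `M₀` among the finite nonzero invariant additive subgroups of `E` makes it a
  -- minimal normal subgroup of the extension.
  obtain ⟨M₀, ⟨_, hM₀, hM₀E, hM₀ne⟩, hmin⟩ :=
    (measure fun L : AddSubgroup M => Nat.card L).wf.has_min
      {L | Finite L ∧ (∀ g, ∀ m ∈ L, σ g m ∈ L) ∧ (∀ m ∈ L, m ∈ E) ∧ L ≠ ⊥}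
      ⟨M₁, hM₁f, hM₁, hM₁E E hE (by simpa using hwE), fun h => hw (by simpa [h] using hwM₁)⟩
  have hc : ∀ x y : X, (0 : X → M) (x * y) - (0 : X → M) x - σ x ((0 : X → M) y) ∈ E := by simp
  have := σ.finite_cocycleSubgroup M₀ hM₀ E hE 0 hc
  -- With the zero cocycle and `M₀` inside `E`, this is the full semidirect product of `M₀` with
  -- `X`.
  set Y := σ.cocycleSubgroup M₀ hM₀ E hE 0 hc
  have hY : ∀ g, ∃ y ∈ Y, y.right = g := fun g =>
    ⟨⟨1, g⟩, ⟨M₀.zero_mem, by simp⟩, rfl⟩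
  have hYE : ∀ y ∈ Y, y.left.toAdd ∈ E := fun y hy => hM₀E _ hy.1
  obtain ⟨⟨a, haM⟩, ha0⟩ := AddSubgroup.ne_bot_iff_exists_ne_zero.1 hM₀ne
  rw [Ne, AddSubgroup.mk_eq_zero] at ha0
  have haY : SemidirectProduct.inl (Multiplicative.ofAdd a) ∈ Y :=
    ⟨haM, by simpa using hM₀E _ haM⟩
  refine ⟨Y, ?_, hY, hYE, _, haY, rfl, ha0⟩
  set π : Y →* X := SemidirectProduct.rightHom.comp Y.subtype
  have hπs : Function.Surjective π := fun g => by
    obtain ⟨y, hy, e⟩ := hY g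
    exact ⟨⟨y, hy⟩, e⟩
  have hr : ∀ a ∈ π.ker, (a : σ.Split).right = 1 := fun a ha => ha
  have hkne : π.ker ≠ ⊥ := fun h => by
    have h1 : (⟨_, haY⟩ : Y) ∈ π.ker := rfl
    rw [h, Subgroup.mem_bot] at h1
    exact ha0 (congrArg (fun z : Y => (z : σ.Split).left.toAdd) h1)
  have hchief : IsChiefFactor π.ker ⊥ := by
    refine ⟨inferInstance, inferInstance, bot_lt_iff_ne_bot.2 hkne, fun L hL _ hLk => ?_⟩
    by_cases hLb : L = ⊥
    · exact Or.inl hLb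
    refine Or.inr (le_antisymm hLk fun y hy => ?_)
    have hle : Split.leftPart L ≤ M₀ := by
      intro m hm
      obtain ⟨b, hb, e⟩ := Split.mem_leftPart.1 hm
      have := b.2.1
      rwa [e] at this
    have hLne : Split.leftPart L ≠ ⊥ := fun h => hLb <| by
      rw [Subgroup.eq_bot_iff_forall]
      intro b hb
      have h1 := Split.toAdd_left_mem_leftPart hb (hr b (hLk hb))
      rw [h, AddSubgroup.mem_bot] at h1
      apply Subtype.ext
      rw [Split.eq_inl (hr b (hLk hb)), show (b : σ.Split).left = 1 from h1, map_one]
      rfl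
    have hfin : Finite (Split.leftPart L) :=
      Finite.of_injective _ (AddSubgroup.inclusion_injective hle)
    have heq : Split.leftPart L = M₀ := AddSubgroup.eq_of_le_of_card_ge hle <| not_lt.1 <|
      hmin _ ⟨hfin, fun g m => Split.apply_mem_leftPart hY g, fun m hm => hM₀E m (hle hm), hLne⟩
    have hyM : (y : σ.Split).left.toAdd ∈ Split.leftPart L := heq ▸ y.2.1
    obtain ⟨b, hb, e⟩ := Split.mem_leftPart.1 hyM
    rw [ofAdd_toAdd, ← Split.eq_inl (hr y hy)] at e
    rwa [← Subtype.ext e]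
  obtain ⟨n, hn⟩ := Split.exists_card_eq_pow hp hr
  refine (hf.mem_iff Y).2 (Loc.of_minimal_normal hf.formation hp hchief hn ?_ ?_)
  · refine ((hf.formation p hp).quotient_comap_iff π hπs N _ ?_).2 hcent
    exact Split.sectionCentralizer_eq_comap hirr hY hkne (fun a ha => ⟨hr a ha, hYE a a.2⟩) hN
  · exact (hf.mem_iff _).1
      (hC.iso _ _ (QuotientGroup.quotientKerEquivOfSurjective π hπs).symm hX)

end Extensions

/-! ### Composition factors and vanishing of cohomology over the cone -/

section Cones

open Representation

variable {F : Type u} [Field F] {G : Type u} [Group G] {V : Type u} [AddCommGroup V] [Module F V]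
  {ρ : Representation F G V}

theorem Subrepresentation.mem_ker_subquotientRep {U W : Subrepresentation ρ} {g : G} :
    g ∈ MonoidHom.ker (subquotientRep U W) ↔ ∀ w ∈ W.toSubmodule, ρ g w - w ∈ U.toSubmodule := by
  rw [MonoidHom.mem_ker]
  constructor
  · intro h w hw
    have h1 := LinearMap.congr_fun h (Submodule.Quotient.mk ⟨w, hw⟩)
    exact (Submodule.Quotient.eq (U.toSubmodule.comap W.toSubmodule.subtype)).1 h1
  · intro h
    ext ⟨w, hw⟩
    exact (Submodule.Quotient.eq (U.toSubmodule.comap W.toSubmodule.subtype)).2 (h w hw)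

theorem Subrepresentation.isIrreducible_subquotientRep {U W : Subrepresentation ρ} (h : U ⋖ W) :
    (subquotientRep U W).IsIrreducible := by
  have hUW : U.toSubmodule ≤ W.toSubmodule := h.le
  refine { exists_pair_ne := ⟨⊥, ⊤, fun e => h.lt.not_ge fun w hw => ?_⟩, eq_bot_or_eq_top := ?_ }
  · have h1 : (Submodule.Quotient.mk ⟨w, hw⟩ :
        W.toSubmodule ⧸ U.toSubmodule.comap W.toSubmodule.subtype) ∈
        (⊥ : Subrepresentation (subquotientRep U W)).toSubmodule := by
      rw [e]
      exact Submodule.mem_top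
    exact (Submodule.Quotient.mk_eq_zero (U.toSubmodule.comap W.toSubmodule.subtype)).1
      ((Submodule.mem_bot F).1 h1)
  · intro S
    let B : Subrepresentation ρ :=
      { toSubmodule := (S.toSubmodule.comap (Submodule.mkQ _)).map W.toSubmodule.subtype
        apply_mem_toSubmodule := by
          rintro g _ ⟨w, hw, rfl⟩
          exact ⟨⟨ρ g w, W.apply_mem_toSubmodule g w.2⟩, S.apply_mem_toSubmodule g hw, rfl⟩ }
    have hUB : U ≤ B := fun u hu => by
      refine ⟨⟨u, hUW hu⟩, ?_, rfl⟩
      have h1 : (U.toSubmodule.comap W.toSubmodule.subtype).mkQ ⟨u, hUW hu⟩ = 0 :=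
        (Submodule.Quotient.mk_eq_zero _).2 hu
      change (U.toSubmodule.comap W.toSubmodule.subtype).mkQ ⟨u, hUW hu⟩ ∈ S.toSubmodule
      rw [h1]
      exact S.toSubmodule.zero_mem
    have hBW : B ≤ W := by
      rintro _ ⟨w, _, rfl⟩
      exact w.2
    have hmem : ∀ w : W.toSubmodule, (w : V) ∈ B.toSubmodule →
        (U.toSubmodule.comap W.toSubmodule.subtype).mkQ w ∈ S.toSubmodule := by
      rintro w ⟨w', hw', e⟩
      rwa [← Subtype.ext e]
    rcases h.eq_or_eq hUB hBW with e | e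
    · left
      apply Subrepresentation.toSubmodule_injective
      refine (Submodule.eq_bot_iff _).2 fun s hs => ?_
      obtain ⟨w, rfl⟩ := Submodule.mkQ_surjective _ s
      refine (Submodule.Quotient.mk_eq_zero _).2 ?_
      change (w : V) ∈ U.toSubmodule
      rw [← e]
      exact ⟨w, hs, rfl⟩
    · right
      apply Subrepresentation.toSubmodule_injective
      refine (Submodule.eq_top_iff').2 fun s => ?_
      obtain ⟨w, rfl⟩ := Submodule.mkQ_surjective _ s
      refine hmem w ?_
      rw [e]
      exact w.2

/-- The quotient of a representation by a subrepresentation. -/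
abbrev Subrepresentation.quotientRep (U : Subrepresentation ρ) :
    Representation F G (V ⧸ U.toSubmodule) :=
  ρ.quotient U.toSubmodule fun g _ hv => U.apply_mem_toSubmodule g hv

section Quotient

variable {U W : Subrepresentation ρ}

theorem Subrepresentation.mkQ_mem_map (h : U ≤ W) {v : V} :
    U.toSubmodule.mkQ v ∈ W.toSubmodule.map U.toSubmodule.mkQ ↔ v ∈ W.toSubmodule := by
  rw [← Submodule.mem_comap, Submodule.comap_map_mkQ,
    sup_eq_right.2 (show U.toSubmodule ≤ W.toSubmodule from h)]

theorem Subrepresentation.map_mkQ_invariant (g : G) :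
    ∀ m ∈ W.toSubmodule.map U.toSubmodule.mkQ,
      U.quotientRep g m ∈ W.toSubmodule.map U.toSubmodule.mkQ := by
  rintro _ ⟨w, hw, rfl⟩
  exact ⟨ρ g w, W.apply_mem_toSubmodule g hw, rfl⟩

theorem Subrepresentation.map_mkQ_ne_bot (h : U ⋖ W) :
    W.toSubmodule.map U.toSubmodule.mkQ ≠ ⊥ := fun e => by
  refine h.lt.not_ge fun w hw => ?_
  have h1 := (mkQ_mem_map h.le).2 hw
  rw [e, Submodule.mem_bot] at h1
  exact (Submodule.Quotient.mk_eq_zero _).1 h1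

theorem Subrepresentation.eq_map_mkQ_of_covBy (h : U ⋖ W)
    (B : Submodule F (V ⧸ U.toSubmodule)) (hB : ∀ g, ∀ m ∈ B, U.quotientRep g m ∈ B)
    (hBW : B ≤ W.toSubmodule.map U.toSubmodule.mkQ) (hne : B ≠ ⊥) :
    B = W.toSubmodule.map U.toSubmodule.mkQ := by
  let L : Subrepresentation ρ := ⟨B.comap U.toSubmodule.mkQ, fun g v hv => hB g _ hv⟩
  have hUL : U ≤ L := fun u hu => by
    have h1 : U.toSubmodule.mkQ u = 0 := (Submodule.Quotient.mk_eq_zero _).2 hu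
    change U.toSubmodule.mkQ u ∈ B
    rw [h1]
    exact B.zero_mem
  have hLW : L ≤ W := fun v hv => (mkQ_mem_map h.le).1 (hBW hv)
  rcases h.eq_or_eq hUL hLW with e | e
  · refine absurd ((Submodule.eq_bot_iff _).2 fun b hb => ?_) hne
    obtain ⟨v, rfl⟩ := Submodule.mkQ_surjective _ b
    refine (Submodule.Quotient.mk_eq_zero _).2 ?_
    rw [← e]
    exact hb
  · refine le_antisymm hBW ?_
    rintro _ ⟨w, hw, rfl⟩
    rw [← e] at hw
    exact hw

theorem Subrepresentation.mem_ker_subquotientRep_iff_quotientRep {g : G} :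
    g ∈ MonoidHom.ker (subquotientRep U W) ↔
      ∀ m ∈ W.toSubmodule.map U.toSubmodule.mkQ, U.quotientRep g m = m := by
  rw [mem_ker_subquotientRep]
  constructor
  · rintro h _ ⟨w, hw, rfl⟩
    exact (Submodule.Quotient.eq _).2 (h w hw)
  · intro h w hw
    exact (Submodule.Quotient.eq _).1 (h _ ⟨w, hw, rfl⟩)

end Quotient

/-- Over the cone of `G` every map which is a cocycle modulo `U` is a coboundary modulo `U`. -/
def VanishesOnCone (C : GroupClass.{u}) (U : Subrepresentation ρ) : Prop :=
  ∀ (K : FormationCone C G) (c : K.X → V),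
    (∀ x y, c (x * y) - c x - ρ (K.ε x) (c y) ∈ U.toSubmodule) →
      ∃ v, ∀ x, c x - (ρ (K.ε x) v - v) ∈ U.toSubmodule

theorem vanishesOnCone_bot {C : GroupClass.{u}}
    (h : ∀ K : FormationCone C G,
      Subsingleton (groupCohomology.H1 (Rep.of (ρ.comp K.ε : Representation F K.X V)))) :
    VanishesOnCone C (⊥ : Subrepresentation ρ) := by
  intro K c hc
  have := h K
  have hc' : c ∈ groupCohomology.cocycles₁ (Rep.of (ρ.comp K.ε : Representation F K.X V)) := by
    rw [groupCohomology.mem_cocycles₁_iff]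
    intro x y
    have h1 : c (x * y) - c x - ρ (K.ε x) (c y) = 0 := (Submodule.mem_bot F).1 (hc x y)
    rw [sub_sub, sub_eq_zero] at h1
    rw [h1, add_comm]
    rfl
  obtain ⟨v, hv⟩ := (groupCohomology.H1π_eq_zero_iff
    (A := Rep.of (ρ.comp K.ε : Representation F K.X V)) ⟨c, hc'⟩).1 (Subsingleton.elim _ _)
  refine ⟨v, fun x => (Submodule.mem_bot F).2 (sub_eq_zero.2 ?_)⟩
  exact (congrFun hv x).symm

variable {C : GroupClass.{u}} {f : ℕ → GroupClass.{u}} {p : ℕ}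

/-- A central factor would supply a group in the cone, a split extension of `G`, whose module
coordinate is a cocycle but not a coboundary. -/
theorem VanishesOnCone.not_central (hC : IsSaturatedFormation C)
    (hf : IsIntegratedLocalDefinition f C) (hp : p.Prime) [CharP F p] (hG : C G)
    {U W : Subrepresentation ρ} (h : U ⋖ W) (hU : VanishesOnCone C U) :
    ¬ f p (G ⧸ MonoidHom.ker (subquotientRep U W)) := by
  intro hcent
  obtain ⟨Y, hY, hYs, hYE, y, hy, hyr, hyl⟩ := exists_split_extension_mem hC hf hp hG
    (σ := U.quotientRep) (fun g => Subrepresentation.map_mkQ_invariant g)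
    (Subrepresentation.eq_map_mkQ_of_covBy h) (Subrepresentation.map_mkQ_ne_bot h)
    (fun _ => Subrepresentation.mem_ker_subquotientRep_iff_quotientRep) hcent
  let K : FormationCone C G :=
    { X := Y
      mem := hY
      ε := SemidirectProduct.rightHom.comp Y.subtype
      surjective := fun g => by
        obtain ⟨y, hy, e⟩ := hYs g
        exact ⟨⟨y, hy⟩, e⟩ }
  -- A set-theoretic section suffices, because cocycles are only required modulo `U`.
  choose s hs using Submodule.mkQ_surjective U.toSubmodule
  obtain ⟨v, hv⟩ := hU K (fun x => s (x : U.quotientRep.Split).left.toAdd) fun x z => by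
    rw [← Submodule.Quotient.mk_eq_zero, ← Submodule.mkQ_apply, map_sub, map_sub, hs, hs,
      Subgroup.coe_mul, Split.toAdd_left_mul, add_sub_cancel_left, sub_eq_zero]
    conv_lhs => rw [← hs (z : U.quotientRep.Split).left.toAdd]
    rfl
  refine hyl ?_
  have h1 := hv ⟨y, hy⟩
  -- Every coboundary vanishes at an element acting trivially, yet the coordinate of `y` is nonzero.
  have h2 : K.ε ⟨y, hy⟩ = 1 := hyr
  rw [h2, map_one, Module.End.one_apply, sub_self, sub_zero] at h1
  rw [← hs y.left.toAdd]
  exact (Submodule.Quotient.mk_eq_zero _).2 h1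

/-- Eccentricity removes the obstruction to lifting a cocycle from `V / W` to `V / U`, where it is a
coboundary by assumption. The factor remains eccentric over `K.X`, because inflation along `K.ε`
leaves the acting quotient unchanged. -/
theorem VanishesOnCone.of_covBy (hC : IsSaturatedFormation C)
    (hf : IsIntegratedLocalDefinition f C) (hp : p.Prime) [CharP F p]
    {U W : Subrepresentation ρ} (h : U ⋖ W)
    (hecc : ¬ f p (G ⧸ MonoidHom.ker (subquotientRep U W)))
    (hU : VanishesOnCone C U) : VanishesOnCone C W := by
  intro K c hc
  have hUW : U.toSubmodule ≤ W.toSubmodule := h.le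
  have hirr : ∀ B : Submodule F (V ⧸ U.toSubmodule),
      (∀ x, ∀ m ∈ B, U.quotientRep (K.ε x) m ∈ B) → B ≤ W.toSubmodule.map U.toSubmodule.mkQ →
      B ≠ ⊥ → B = W.toSubmodule.map U.toSubmodule.mkQ := fun B hB =>
    Subrepresentation.eq_map_mkQ_of_covBy h B fun g => by
      obtain ⟨x, rfl⟩ := K.surjective g
      exact hB x
  have hker : ∀ x, x ∈ (MonoidHom.ker (subquotientRep U W)).comap K.ε ↔
      ∀ m ∈ W.toSubmodule.map U.toSubmodule.mkQ, U.quotientRep (K.ε x) m = m := fun x =>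
    Subgroup.mem_comap.trans
      (Subrepresentation.mem_ker_subquotientRep_iff_quotientRep (g := K.ε x))
  have hecc' : ¬ f p (K.X ⧸ (MonoidHom.ker (subquotientRep U W)).comap K.ε) :=
    fun h' => hecc (((hf.formation p hp).quotient_comap_iff K.ε K.surjective _ _ rfl).1 h')
  have hcW : ∀ x y, U.toSubmodule.mkQ (c (x * y)) - U.toSubmodule.mkQ (c x) -
      U.quotientRep (K.ε x) (U.toSubmodule.mkQ (c y)) ∈ W.toSubmodule.map U.toSubmodule.mkQ :=
    fun x y => (Subrepresentation.mkQ_mem_map h.le).2 (hc x y)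
  obtain ⟨d, hd, hd'⟩ : ∃ d : K.X → V ⧸ U.toSubmodule,
      (∀ x, d x - U.toSubmodule.mkQ (c x) ∈ W.toSubmodule.map U.toSubmodule.mkQ) ∧
      ∀ x y, d (x * y) = d x + U.quotientRep (K.ε x) (d y) :=
    exists_cocycle_lift (σ := (U.quotientRep.comp K.ε : Representation F K.X (V ⧸ U.toSubmodule)))
      hC hf hp K.mem (fun x => Subrepresentation.map_mkQ_invariant (K.ε x)) hirr hker hecc' _ hcW
  choose s hs using Submodule.mkQ_surjective U.toSubmodule
  obtain ⟨v, hv⟩ := hU K (fun x => s (d x)) fun x y => by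
    rw [← Submodule.Quotient.mk_eq_zero, ← Submodule.mkQ_apply, map_sub, map_sub, hs, hs,
      hd', add_sub_cancel_left, sub_eq_zero]
    conv_lhs => rw [← hs (d y)]
    rfl
  refine ⟨v, fun x => ?_⟩
  have h1 : s (d x) - c x ∈ W.toSubmodule := by
    refine (Subrepresentation.mkQ_mem_map h.le).1 ?_
    rw [map_sub, hs]
    exact hd x
  have h2 := W.toSubmodule.sub_mem (hUW (hv x)) h1
  convert h2 using 1
  abel

theorem VanishesOnCone.of_bot [FiniteDimensional F V] (hC : IsSaturatedFormation C)
    (hf : IsIntegratedLocalDefinition f C) (hp : p.Prime) [CharP F p] (hG : C G)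
    (h : VanishesOnCone C (⊥ : Subrepresentation ρ)) (W : Subrepresentation ρ) :
    VanishesOnCone C W := by
  have hmono : StrictMono (Subrepresentation.toSubmodule : Subrepresentation ρ → _) :=
    fun _ _ h => h
  have : WellFoundedLT (Subrepresentation ρ) := hmono.wellFoundedLT
  have : WellFoundedGT (Subrepresentation ρ) := hmono.wellFoundedGT
  induction W using WellFoundedLT.induction with
  | ind W ih =>
    rcases eq_or_ne W ⊥ with rfl | hW
    · exact h
    -- Vanishing at `U` itself shows that `W / U` is eccentric, which is what permits the step up to
    -- `W`.
    · obtain ⟨U, -, hUW⟩ := exists_le_covBy_of_lt (bot_lt_iff_ne_bot.2 hW)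
      have hU := ih U hUW.lt
      exact hU.of_covBy hC hf hp hUW (hU.not_central hC hf hp hG hUW)

end Cones

theorem mainTheorem3
    (C : GroupClass.{u}) (hC : IsSaturatedFormation C)
    (f : ℕ → GroupClass.{u}) (hf : IsIntegratedLocalDefinition f C)
    (p : ℕ) (hp : p.Prime) (F : Type u) [Field F] [CharP F p]
    (G : Type u) [Group G] (hG : C G)
    (V : Type u) [AddCommGroup V] [Module F V] [FiniteDimensional F V]
    (ρ : Representation F G V)
    (hH1 : ∀ K : FormationCone C G,
      Subsingleton (groupCohomology.H1 (Rep.of (ρ.comp K.ε : Representation F K.X V)))) :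
    IsHypereccentric f p ρ := by
  intro U W h
  have hU := VanishesOnCone.of_bot hC hf hp hG (vanishesOnCone_bot hH1) U
  exact ⟨Subrepresentation.isIrreducible_subquotientRep h,
    fun hc => hU.not_central hC hf hp hG h hc.2⟩
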